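/- **Universal approximation for pre-norm LN-Sessa.** *Sessa blocks.* Fix a horizon $T\ge 1$ and a RoPE base $\vartheta>1$. Let $m\ge 2$, let $d_k\ge 2$ be even, and let $\varepsilon_{\ln}>0$. Tokens are row vectors. For $z\in\mathbb R^m$ put $\mu(z)=\frac1m\sum_i z_i$, $\sigma(z)=\sqrt{\frac1m\|z-\mu(z)\mathbf 1\|_2^2+\varepsilon_{\ln}}$ and $\mathrm{LN}_{\varepsilon_{\ln}}(z)=(z-\mu(z)\mathbf 1)/\sigma(z)$. Let $\mathrm{GELU}(z)=z\,\Phi(z)$ (applied coordinatewise), where $\Phi$ is the standard normal distribution function. Write $z\in\mathbb R^{d_k}$ as $(z^{(0)},\dots,z^{(d_k/2-1)})$ with $z^{(r)}\in\mathbb R^2$, and let $\mathrm{RoPE}_\tau(z)$ be obtained by rotating $z^{(r)}$ by the angle $\vartheta^{-2r/d_k}\tau$ for each $r$. A pre-norm LN-Sessa block of width $m$ has parameters $W^{\mathrm{in}}\in\mathbb R^{m\times 2m}$, $b^{\mathrm{in}}\in\mathbb R^{2m}$, $W_{Qf},W_{Kf},W_{Qb},W_{Kb}\in\mathbb R^{m\times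 d_k}$, $W_V,W^{\mathrm{out}}\in\mathbb R^{m\times m}$, $w^\gamma,b^{\mathrm{out}}\in\mathbb R^m$, $b^\gamma\in\mathbb R$, and maps $x\in\mathbb R^{T\times m}$ (rows $x_0,\dots,x_{T-1}$) to $y\in\mathbb R^{T\times m}$ as follows: $$(a_t,g_t)=\mathrm{LN}_{\varepsilon_{\ln}}(x_t)W^{\mathrm{in}}+b^{\mathrm{in}},\qquad \bar a_t=\mathrm{GELU}(a_t),$$ $$f_t=\sum_{j\le t}\alpha^f_{t,j}\,\bar a_jW_V,\qquad \alpha^f_{t,\cdot}=\operatorname{softmax}_{j\le t}\Big(d_k^{-1/2}\big\langle \mathrm{RoPE}_t(\bar a_tW_{Qf}),\mathrm{RoPE}_j(\bar a_jW_{Kf})\big\rangle\Big),$$ $$B_{t,j}=\tanh\big(\langle\bar a_t,w^\gamma\rangle+b^\gamma\big)\,\alpha^b_{t,j},\qquad \alpha^b_{t,\cdot}=\operatorname{softmax}_{j<t}\Big(d_k^{-1/2}\big\langle \bar a_tW_{Qb},\bar a_jW_{Kb}\big\rangle\Big),\qquad B_{t,j}=0\ \text{ for } j\ge t,$$ $s\in\mathbb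 R^{T\times m}$ is the unique solution of $(I-B)s=f$, and $y_t=x_t+(s_t\odot g_t)W^{\mathrm{out}}+b^{\mathrm{out}}$. Let $\Omega^{d_k}_{\mathrm{LN}_{\varepsilon_{\ln}}}(m)$ be the set of all compositions $G_N\circ\cdots\circ G_1$, $N\ge 1$, of such blocks. *Theorem.* Let $T\ge1$, $d\ge 1$, let $\mathcal D\subset\mathbb R^{T\times d}$ be compact, and let $F:\mathcal D\to\mathbb R^{T\times d}$ be continuous and causal, i.e. for all $t$ and all $x,x'\in\mathcal D$, if $x_j=x'_j$ for all $j\le t$ then $F(x)_t=F(x')_t$. Fix $\vartheta>1$ and $\varepsilon_{\ln}>0$. Then for every $\varepsilon>0$ there exist a model width $m\ge\max(d,2)$, an even query/key width $d_k\ge2$, tokenwise affine adapters $$\mathrm{Embed}(x)_t=x_tW^{\mathrm{emb}}+b^{\mathrm{emb}}\in\mathbb R^m,\qquad \mathrm{Unembed}(h)_t=h_tW^{\mathrm{un}}+b^{\mathrm{un}}\in\mathbb R^d$$ with $\mathrm{Unembed}\circ\mathrm{Embed}=\mathrm{Id}$ on $\mathbb R^{T\times d}$, and a network $G\in\Omega^{d_k}_{\mathrm{LN}_{\varepsilon_{\ln}}}(m)$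 such that $$\sup_{x\in\mathcal D}\big\|F(x)-\mathrm{Unembed}\big(G(\mathrm{Embed}(x))\big)\big\|_F<\varepsilon .$$ -/

import Mathlib

noncomputable section

namespace Sessa

/-- Token sequences of length `T` and token width `m`, that is `ℝ^{T × m}`; row `t` is token `t`. -/
abbrev Seq (T m : ℕ) : Type := Matrix (Fin T) (Fin m) ℝ

/-- The Frobenius norm on `ℝ^{T × m}`. -/
def frobNorm {T m : ℕ} (X : Seq T m) : ℝ :=
  Real.sqrt (∑ t, ∑ i, X t i ^ 2)

/-- A map defined on a set of sequences is causal if its output at time `t` depends only on the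
tokens at times `0, …, t`. -/
def Causal {T d : ℕ} {D : Set (Seq T d)} (F : D → Seq T d) : Prop :=
  ∀ (t : Fin T) (x x' : D), (∀ j ≤ t, x.1 j = x'.1 j) → F x t = F x' t

/-- `GELU(z) = z Φ(z)`, with `Φ` the standard normal distribution function. -/
def gelu (z : ℝ) : ℝ :=
  z * ProbabilityTheory.cdf (ProbabilityTheory.gaussianReal 0 1) z

/-! ### LayerNorm of one token (no learnable affine part) -/

/-- Mean of the coordinates. -/
def lnMean {m : ℕ} (z : Fin m → ℝ) : ℝ := (∑ i, z i) / m

/-- Regularized standard deviation of the coordinates. -/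
def lnSigma {m : ℕ} (ε : ℝ) (z : Fin m → ℝ) : ℝ :=
  Real.sqrt ((∑ i, (z i - lnMean z) ^ 2) / m + ε)

/-- `LN_ε(z) = (z - mean(z) 𝟏) / σ_ε(z)`. -/
def layerNorm {m : ℕ} (ε : ℝ) (z : Fin m → ℝ) : Fin m → ℝ :=
  fun i => (z i - lnMean z) / lnSigma ε z

/-! ### Rotary position embedding -/

/-- For even `dk`, the coordinates of `ℝ^dk` grouped into `dk / 2` consecutive pairs:
`(r, 0)` and `(r, 1)` are the two coordinates of the `r`-th pair. -/
abbrev QK (dk : ℕ) : Type := Fin (dk / 2) × Fin 2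

/-- The frequency `ω_r = ϑ ^ (-2 r / dk)` of the `r`-th pair. -/
def ropeFreq (ϑ : ℝ) (dk : ℕ) (r : Fin (dk / 2)) : ℝ :=
  ϑ ^ (-(2 * ((r : ℕ) : ℝ) / (dk : ℝ)))

/-- `RoPE_τ` rotates the `r`-th pair by the angle `ω_r τ`. -/
def rope (ϑ : ℝ) {dk : ℕ} (τ : ℝ) (z : QK dk → ℝ) : QK dk → ℝ := fun p =>
  let θ := ropeFreq ϑ dk p.1 * τ
  if p.2 = 0 then Real.cos θ * z (p.1, 0) - Real.sin θ * z (p.1, 1)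
  else Real.sin θ * z (p.1, 0) + Real.cos θ * z (p.1, 1)

/-! ### The Sessa block -/

/-- The parameters of a Sessa block of model width `m` and query/key width `dk`. Tokens are row
vectors, so weight matrices act from the right. The `2 m` output coordinates of the input
projection are indexed by `Fin m ⊕ Fin m`: first the branch `a`, then the gate `g`. -/
structure BlockParams (dk m : ℕ) where
  Win : Matrix (Fin m) (Fin m ⊕ Fin m) ℝ
  bin : Fin m ⊕ Fin m → ℝ
  WQf : Matrix (Fin m) (QK dk) ℝ
  WKf : Matrix (Fin m) (QK dk) ℝ
  WQb : Matrix (Fin m) (QK dk) ℝ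
  WKb : Matrix (Fin m) (QK dk) ℝ
  WV : Matrix (Fin m) (Fin m) ℝ
  wγ : Fin m → ℝ
  bγ : ℝ
  Wout : Matrix (Fin m) (Fin m) ℝ
  bout : Fin m → ℝ

/-- The attention scale `dk ^ (-1/2)`. -/
def attnScale (dk : ℕ) : ℝ := (Real.sqrt dk)⁻¹

/-- Forward attention weights: softmax over `j ≤ t` of the scaled inner products of the rotated
queries and keys, and `0` for `j > t`. -/
def fwdWeights (ϑ : ℝ) {T dk : ℕ} (Q K : Matrix (Fin T) (QK dk) ℝ) :
    Matrix (Fin T) (Fin T) ℝ := fun t j =>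
  let logit : Fin T → ℝ := fun τ =>
    attnScale dk * (rope ϑ ((t : ℕ) : ℝ) (Q t) ⬝ᵥ rope ϑ ((τ : ℕ) : ℝ) (K τ))
  if j ≤ t then Real.exp (logit j) / ∑ τ ∈ Finset.Iic t, Real.exp (logit τ) else 0

/-- Feedback attention weights: softmax over the strict past `j < t` of the scaled inner products
of queries and keys (no positional encoding), and `0` for `j ≥ t`. -/
def fbWeights {T dk : ℕ} (Q K : Matrix (Fin T) (QK dk) ℝ) :
    Matrix (Fin T) (Fin T) ℝ := fun t j =>
  let logit : Fin T → ℝ := fun τ => attnScale dk * (Q t ⬝ᵥ K τ)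
  if j < t then Real.exp (logit j) / ∑ τ ∈ Finset.Iio t, Real.exp (logit τ) else 0

/-- The strictly lower triangular feedback matrix `B_{t,j} = γ_t α_{t,j}`, where
`γ_t = tanh(⟨ā_t, w^γ⟩ + b^γ)` and `α` are the feedback attention weights. -/
def feedbackMatrix {T dk m : ℕ} (P : BlockParams dk m) (abar : Seq T m) :
    Matrix (Fin T) (Fin T) ℝ := fun t j =>
  Real.tanh (abar t ⬝ᵥ P.wγ + P.bγ) * fbWeights (abar * P.WQb) (abar * P.WKb) t j

/-- The forward signal `f_t = ∑_{j ≤ t} α_{t,j} v_j`. -/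
def forwardSignal (ϑ : ℝ) {T dk m : ℕ} (P : BlockParams dk m) (abar : Seq T m) : Seq T m :=
  fwdWeights ϑ (abar * P.WQf) (abar * P.WKf) * (abar * P.WV)

/-- The mixer output: the solution `s` of `(I - B) s = f`. The matrix `I - B` is unit lower
triangular, so this is the unique solution; see `eq_mixer_iff`. -/
def mixer (ϑ : ℝ) {T dk m : ℕ} (P : BlockParams dk m) (abar : Seq T m) : Seq T m :=
  (1 - feedbackMatrix P abar)⁻¹ * forwardSignal ϑ P abar

theorem det_one_sub_feedbackMatrix {T dk m : ℕ} (P : BlockParams dk m) (abar : Seq T m) :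
    (1 - feedbackMatrix P abar).det = 1 := by
  rw [Matrix.det_of_isLowerTriangular]
  · refine Finset.prod_eq_one fun t _ => ?_
    simp [feedbackMatrix, fbWeights]
  · intro i j hij
    have h : i < j := by simpa using hij
    simp [feedbackMatrix, fbWeights, Matrix.one_apply_ne h.ne, h.not_gt]

theorem eq_mixer_iff (ϑ : ℝ) {T dk m : ℕ} (P : BlockParams dk m) (abar s : Seq T m) :
    s = mixer ϑ P abar ↔ (1 - feedbackMatrix P abar) * s = forwardSignal ϑ P abar := by
  have hu : IsUnit (1 - feedbackMatrix P abar).det := by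
    rw [det_one_sub_feedbackMatrix]; exact isUnit_one
  unfold mixer
  constructor
  · rintro rfl
    rw [Matrix.mul_nonsing_inv_cancel_left _ _ hu]
  · intro h
    rw [← h, Matrix.nonsing_inv_mul_cancel_left _ _ hu]

/-- The input projection `u_t = Norm(x_t) W^in + b^in`, with a tokenwise pre-normalization map. -/
def inputProj {T dk m : ℕ} (norm : (Fin m → ℝ) → (Fin m → ℝ)) (P : BlockParams dk m)
    (x : Seq T m) : Matrix (Fin T) (Fin m ⊕ Fin m) ℝ := fun t i =>
  Matrix.vecMul (norm (x t)) P.Win i + P.bin i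

/-- The Sessa block with pre-normalization map `norm`, parameters `P` and RoPE base `ϑ`:
`y_t = x_t + ((s_t ⊙ g_t) W^out + b^out)` with `s = Mixer(GELU(a))`. -/
def block (ϑ : ℝ) {T dk m : ℕ} (norm : (Fin m → ℝ) → (Fin m → ℝ)) (P : BlockParams dk m)
    (x : Seq T m) : Seq T m :=
  let abar : Seq T m := fun t i => gelu (inputProj norm P x t (Sum.inl i))
  let g : Seq T m := fun t i => inputProj norm P x t (Sum.inr i)
  let s : Seq T m := mixer ϑ P abar
  fun t i => x t i + (Matrix.vecMul (fun k => s t k * g t k) P.Wout i + P.bout i)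

/-- The set of all Sessa blocks of model width `m` and query/key width `dk`. -/
def blocks (ϑ : ℝ) (T dk m : ℕ) (norm : (Fin m → ℝ) → (Fin m → ℝ)) :
    Set (Seq T m → Seq T m) :=
  Set.range fun P : BlockParams dk m => block ϑ norm P

/-- Sessa networks: the finite compositions `G_N ∘ ⋯ ∘ G_1`, `N ≥ 1`, of Sessa blocks. -/
inductive IsNetwork (ϑ : ℝ) {T : ℕ} (dk m : ℕ) (norm : (Fin m → ℝ) → (Fin m → ℝ)) :
    (Seq T m → Seq T m) → Prop
  | single (G : Seq T m → Seq T m) : G ∈ blocks ϑ T dk m norm → IsNetwork ϑ dk m norm G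
  | comp (G H : Seq T m → Seq T m) : G ∈ blocks ϑ T dk m norm → IsNetwork ϑ dk m norm H →
      IsNetwork ϑ dk m norm (G ∘ H)

/-- The tokenwise affine map `x_t ↦ x_t W + b`; adapters have this form. -/
def adapter {T d m : ℕ} (W : Matrix (Fin d) (Fin m) ℝ) (b : Fin m → ℝ) (x : Seq T d) : Seq T m :=
  fun t i => Matrix.vecMul (x t) W i + b i

end Sessa

end

/-!
The proof uses only blocks with constant attention logits, so that forward attention is the causal
average `A`, `(A u)_t = (u_0 + ⋯ + u_t) / (t + 1)`. Since `GELU(z) - GELU(-z) = z`, two units of the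
branch `a` pass an affine functional through the nonlinearity unchanged, and such a block adds
`A(ℓ(x) + c) ⬝ (ℓ'(x) + c')` to one channel (`block_writeParams_zero`).

LayerNorm disappears in a limit. A shift of size `1 / s` in an unused channel makes `σ` asymptotic
to a constant multiple of `1 / s`; rescaling the input weights by this constant and letting `s → 0`
yields the block without LayerNorm, uniformly on compact sets. For the compact-open topology,
composition is continuous on the locally compact space of states, so the closure of the networks is
closed under composition, and it contains all these blocks (`writeMap_mem_closure`).

Call a channel computable if it is affine in the registers of a straight-line program that uses the
operation `A(u) ⬝ v`. Because `A` is invertible, `A⁻¹` is a polynomial in `A` (Cayley–Hamilton), and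
`u v = A(A⁻¹ u) v` shows that the computable channels form an algebra. Constant inputs are
fixed by `A`, so positions have to come from elsewhere: the feedback loop with constant gain turns a
constant into a strictly increasing sequence (`strictMono_feedbackPos`). Polynomials in it give the
indicators of single times, hence all prefixes of the input (`broadcast_mem_computable`), and
Stone–Weierstrass on the prefixes shows that computable channels approximate every continuous
causal map (`exists_computable_near_causal`). A program of length `n` is run in width `d + n + 2`,
with one channel for each input coordinate and register (`IsProgram.exists_isState`).
-/

noncomputable section

namespace Sessa

/-! ### GELU and the normal distribution function -/

theorem cdf_gaussianReal_add_neg (z : ℝ) :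
    ProbabilityTheory.cdf (ProbabilityTheory.gaussianReal 0 1) z +
      ProbabilityTheory.cdf (ProbabilityTheory.gaussianReal 0 1) (-z) = 1 := by
  set μ := ProbabilityTheory.gaussianReal 0 1 with hμ
  have : MeasureTheory.NullSingletonClass μ :=
    ProbabilityTheory.nullSingletonClass_gaussianReal one_ne_zero
  have hneg : μ.real (Set.Iic (-z)) = μ.real (Set.Ioi z) := by
    have hmap : μ.map (fun x => -x) = μ := by
      rw [hμ, ProbabilityTheory.gaussianReal_map_neg, neg_zero]
    have hpre : (fun x : ℝ => -x) ⁻¹' Set.Iic (-z) = Set.Ici z := by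
      ext x; simp
    calc μ.real (Set.Iic (-z)) = (μ.map (fun x => -x)).real (Set.Iic (-z)) := by rw [hmap]
      _ = μ.real (Set.Ici z) := by
        rw [MeasureTheory.map_measureReal_apply measurable_neg measurableSet_Iic, hpre]
      _ = μ.real (Set.Ioi z) :=
        MeasureTheory.measureReal_congr MeasureTheory.Ioi_ae_eq_Ici.symm
  rw [ProbabilityTheory.cdf_eq_real, ProbabilityTheory.cdf_eq_real, hneg, ← Set.compl_Iic,
    MeasureTheory.probReal_compl_eq_one_sub measurableSet_Iic]
  ring

/-- Two GELU units reproduce the identity exactly, because the normal law is symmetric. -/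
theorem gelu_sub_gelu_neg (z : ℝ) : gelu z - gelu (-z) = z := by
  have h := cdf_gaussianReal_add_neg z
  unfold gelu
  linear_combination z * h

/-! ### Blocks with uniform attention -/

/-- The matrix of causal averages, `(A u)_t = (u_0 + ⋯ + u_t) / (t + 1)`. -/
def causalAvg (T : ℕ) : Matrix (Fin T) (Fin T) ℝ := fun t j =>
  if j ≤ t then (((t : ℕ) : ℝ) + 1)⁻¹ else 0

theorem causalAvg_mulVec {T : ℕ} (u : Fin T → ℝ) (t : Fin T) :
    (causalAvg T).mulVec u t = (((t : ℕ) : ℝ) + 1)⁻¹ * ∑ j ∈ Finset.Iic t, u j := by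
  simp only [Matrix.mulVec, dotProduct, causalAvg, ite_mul, zero_mul]
  rw [← Finset.sum_filter, Finset.mul_sum]
  refine Finset.sum_congr ?_ fun _ _ => rfl
  ext j; simp

theorem causalAvg_mulVec_one (T : ℕ) : (causalAvg T).mulVec 1 = 1 := by
  ext t
  rw [causalAvg_mulVec]
  have : ((t : ℕ) : ℝ) + 1 ≠ 0 := by positivity
  simp [this]

theorem fwdWeights_zero (ϑ : ℝ) (T dk : ℕ) :
    fwdWeights ϑ (0 : Matrix (Fin T) (QK dk) ℝ) 0 = causalAvg T := by
  ext t j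
  have h (τ : ℝ) : rope ϑ τ (0 : QK dk → ℝ) = 0 := by ext p; simp [rope]
  have h' (τ : ℝ) (i : Fin T) : rope ϑ τ ((0 : Matrix (Fin T) (QK dk) ℝ) i) = 0 := h τ
  simp [fwdWeights, causalAvg, h']

theorem fbWeights_zero (T dk : ℕ) (t j : Fin T) :
    fbWeights (0 : Matrix (Fin T) (QK dk) ℝ) 0 t j = if j < t then (((t : ℕ) : ℝ))⁻¹ else 0 := by
  have h (i k : Fin T) : (0 : Matrix (Fin T) (QK dk) ℝ) i ⬝ᵥ (0 : Matrix (Fin T) (QK dk) ℝ) k = 0 :=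
    zero_dotProduct _
  simp [fbWeights, h]

/-- Block parameters with uniform attention and constant feedback gain `tanh β`. The units `q` and
`z` of the branch `a` carry `±(ℓ(x) + c)`, so that the value projection recovers `ℓ(x) + c`; the
gate is `ℓ'(x) + c'`, only channel `q` is written, and `b` is the output bias. -/
def writeParams {m : ℕ} (β : ℝ) (ℓ ℓ' : Fin m → ℝ) (c c' : ℝ) (q z : Fin m) (b : Fin m → ℝ) :
    BlockParams 2 m where
  Win := fun i => Sum.elim (fun k => if k = q then ℓ i else if k = z then -ℓ i else 0) fun _ => ℓ' i
  bin := Sum.elim (fun k => if k = q then c else if k = z then -c else 0) fun _ => c'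
  WQf := 0
  WKf := 0
  WQb := 0
  WKb := 0
  WV := fun k _ => if k = q then 1 else if k = z then -1 else 0
  wγ := 0
  bγ := β
  Wout := fun k i => if k = q ∧ i = q then 1 else 0
  bout := b

/-- The hypothesis on `w` says that `w` is, in each channel, the mixer output. At `t = 0` the sum is
empty, so that the value of `0⁻¹` plays no role. -/
theorem block_writeParams {T m : ℕ} (ϑ : ℝ) (norm : (Fin m → ℝ) → (Fin m → ℝ)) (β : ℝ)
    (ℓ ℓ' : Fin m → ℝ) (c c' : ℝ) {q z : Fin m} (hqz : q ≠ z) (b : Fin m → ℝ) (x : Seq T m)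
    (w : Fin T → ℝ)
    (hw : ∀ t, w t = (causalAvg T).mulVec (fun j => norm (x j) ⬝ᵥ ℓ + c) t +
      Real.tanh β * ((((t : ℕ) : ℝ))⁻¹ * ∑ j ∈ Finset.Iio t, w j)) (t : Fin T) (i : Fin m) :
    block ϑ norm (writeParams β ℓ ℓ' c c' q z b) x t i =
      x t i + ((if i = q then w t * (norm (x t) ⬝ᵥ ℓ' + c') else 0) + b i) := by
  set P := writeParams β ℓ ℓ' c c' q z b with hP
  set abar : Seq T m := fun t i => gelu (inputProj norm P x t (Sum.inl i)) with habar
  have hV : abar * P.WV = fun j _ => norm (x j) ⬝ᵥ ℓ + c := by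
    ext j k
    have hq : inputProj norm P x j (Sum.inl q) = norm (x j) ⬝ᵥ ℓ + c := by
      simp [inputProj, hP, writeParams, Matrix.vecMul]
    have hz : inputProj norm P x j (Sum.inl z) = -(norm (x j) ⬝ᵥ ℓ + c) := by
      simp [inputProj, hP, writeParams, Matrix.vecMul, hqz.symm, dotProduct]
      ring
    have hs : ∀ i, abar j i * P.WV i k = (if i = q then abar j q else 0) +
        (if i = z then -abar j z else 0) := by
      intro i
      rcases eq_or_ne i q with rfl | h1
      · simp [hP, writeParams, hqz]
      · rcases eq_or_ne i z with rfl | h2 <;> simp [writeParams, *]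
    rw [Matrix.mul_apply, Finset.sum_congr rfl fun i _ => hs i, Finset.sum_add_distrib]
    simp only [Finset.sum_ite_eq', Finset.mem_univ, if_true]
    rw [habar]
    simp only [hq, hz]
    rw [← sub_eq_add_neg, gelu_sub_gelu_neg]
  have hmix : (Matrix.of fun t _ => w t : Seq T m) = mixer ϑ P abar := by
    rw [eq_mixer_iff]
    ext t k
    have hB : ∀ j, feedbackMatrix P abar t j =
        if j < t then Real.tanh β * (((t : ℕ) : ℝ))⁻¹ else 0 := by
      intro j
      have h1 : abar * P.WQb = 0 := by simp [hP, writeParams]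
      have h2 : abar * P.WKb = 0 := by simp [hP, writeParams]
      rw [feedbackMatrix, h1, h2, fbWeights_zero]
      simp [hP, writeParams]
    have hf : forwardSignal ϑ P abar t k =
        (causalAvg T).mulVec (fun j => norm (x j) ⬝ᵥ ℓ + c) t := by
      have h1 : abar * P.WQf = 0 := by simp [hP, writeParams]
      have h2 : abar * P.WKf = 0 := by simp [hP, writeParams]
      rw [forwardSignal, h1, h2, fwdWeights_zero, hV]
      rfl
    rw [hf, Matrix.sub_mul, Matrix.one_mul, Matrix.sub_apply, Matrix.mul_apply]
    simp only [Matrix.of_apply, hB, ite_mul, zero_mul]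
    rw [hw t]
    rw [← Finset.sum_filter, Finset.mul_sum, Finset.mul_sum, add_sub_assoc, add_eq_left, sub_eq_zero]
    refine Finset.sum_congr ?_ fun _ _ => by ring
    ext j; simp
  have hg : ∀ k, inputProj norm P x t (Sum.inr k) = norm (x t) ⬝ᵥ ℓ' + c' := by
    intro k
    simp [inputProj, hP, writeParams, Matrix.vecMul]
  have hout : Matrix.vecMul (fun k => mixer ϑ P abar t k * inputProj norm P x t (Sum.inr k))
      P.Wout i = if i = q then w t * (norm (x t) ⬝ᵥ ℓ' + c') else 0 := by
    rw [← hmix]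
    simp only [hg]
    by_cases h : i = q <;> simp [Matrix.vecMul, dotProduct, hP, writeParams, h]
  change x t i + (Matrix.vecMul (fun k => mixer ϑ P abar t k * inputProj norm P x t (Sum.inr k))
      P.Wout i + P.bout i) = _
  rw [hout]
  rfl

/-- Without feedback the mixer is the causal average. -/
theorem block_writeParams_zero {T m : ℕ} (ϑ : ℝ) (norm : (Fin m → ℝ) → (Fin m → ℝ))
    (ℓ ℓ' : Fin m → ℝ) (c c' : ℝ) {q z : Fin m} (hqz : q ≠ z) (b : Fin m → ℝ) (x : Seq T m)
    (t : Fin T) (i : Fin m) :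
    block ϑ norm (writeParams 0 ℓ ℓ' c c' q z b) x t i =
      x t i + ((if i = q then (causalAvg T).mulVec (fun j => norm (x j) ⬝ᵥ ℓ + c) t *
        (norm (x t) ⬝ᵥ ℓ' + c') else 0) + b i) :=
  block_writeParams ϑ norm 0 ℓ ℓ' c c' hqz b x _ (fun t => by simp) t i

/-! ### Positions from feedback -/

/-- The response of the feedback loop with gain `1/2` to a constant input: the solution of
`p_0 = 1` and `p_t = 1 + (p_0 + ⋯ + p_{t-1}) / (2 t)` for `t ≥ 1`, in one-step form. -/
def feedbackPos : ℕ → ℝ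
  | 0 => 1
  | t + 1 => feedbackPos t + (1 - feedbackPos t / 2) / ((t : ℝ) + 1)

theorem feedbackPos_lt_two (t : ℕ) : feedbackPos t < 2 := by
  induction t with
  | zero => norm_num [feedbackPos]
  | succ t ih =>
    have ht : (0 : ℝ) < (t : ℝ) + 1 := by positivity
    have : (1 - feedbackPos t / 2) / ((t : ℝ) + 1) ≤ 1 - feedbackPos t / 2 :=
      div_le_self (by linarith) (by linarith [(Nat.cast_nonneg t : (0 : ℝ) ≤ t)])
    rw [feedbackPos]
    linarith

theorem strictMono_feedbackPos : StrictMono feedbackPos := by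
  refine strictMono_nat_of_lt_succ fun t => ?_
  have h := feedbackPos_lt_two t
  have : 0 < (1 - feedbackPos t / 2) / ((t : ℝ) + 1) := div_pos (by linarith) (by positivity)
  rw [feedbackPos]
  linarith

theorem mul_feedbackPos_sub_one (t : ℕ) :
    (t : ℝ) * (feedbackPos t - 1) = 1 / 2 * ∑ j ∈ Finset.range t, feedbackPos j := by
  induction t with
  | zero => simp
  | succ t ih =>
    have ht : (t : ℝ) + 1 ≠ 0 := by positivity
    rw [Finset.sum_range_succ, mul_add, ← ih, feedbackPos]
    push_cast
    field_simp
    ring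

theorem feedbackPos_eq {T : ℕ} (t : Fin T) :
    feedbackPos t = 1 + 1 / 2 * ((((t : ℕ) : ℝ))⁻¹ * ∑ j ∈ Finset.Iio t, feedbackPos j) := by
  have hsum : ∑ j ∈ Finset.Iio t, feedbackPos j = ∑ j ∈ Finset.range t, feedbackPos j := by
    rw [← Nat.Iio_eq_range, ← Fin.map_valEmbedding_Iio, Finset.sum_map]
    rfl
  rw [hsum]
  have h := mul_feedbackPos_sub_one t
  rcases Nat.eq_zero_or_pos (t : ℕ) with h0 | h0
  · simp [h0, feedbackPos]
  · have : ((t : ℕ) : ℝ) ≠ 0 := by positivity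
    field_simp
    linarith

theorem block_writeParams_feedbackPos {T m : ℕ} (ϑ : ℝ) (norm : (Fin m → ℝ) → (Fin m → ℝ))
    {q z : Fin m} (hqz : q ≠ z) (x : Seq T m) (t : Fin T) (i : Fin m) :
    block ϑ norm (writeParams (Real.artanh (1 / 2)) 0 0 1 1 q z 0) x t i =
      x t i + if i = q then feedbackPos t else 0 := by
  rw [block_writeParams ϑ norm _ 0 0 1 1 hqz 0 x (fun t => feedbackPos t)]
  · simp
  · intro t
    rw [Real.tanh_artanh (by norm_num)]
    have : (fun j : Fin T => norm (x j) ⬝ᵥ (0 : Fin m → ℝ) + 1) = 1 := by ext; simp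
    rw [this, causalAvg_mulVec_one]
    exact feedbackPos_eq t

/-! ### Removing the LayerNorm in the limit of a large shift -/

theorem lnSigma_smul {m : ℕ} {s : ℝ} (hs : 0 < s) (ε : ℝ) (v : Fin m → ℝ) :
    lnSigma (s ^ 2 * ε) (s • v) = s * lnSigma ε v := by
  have hmean : lnMean (s • v) = s * lnMean v := by
    simp [lnMean, ← Finset.mul_sum, mul_div_assoc]
  have h : (∑ i, ((s • v) i - lnMean (s • v)) ^ 2) / m + s ^ 2 * ε =
      s ^ 2 * ((∑ i, (v i - lnMean v) ^ 2) / m + ε) := by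
    have : ∀ i, ((s • v) i - lnMean (s • v)) ^ 2 = s ^ 2 * (v i - lnMean v) ^ 2 := by
      intro i
      rw [hmean, Pi.smul_apply, smul_eq_mul]
      ring
    rw [Finset.sum_congr rfl fun i _ => this i, ← Finset.mul_sum]
    ring
  rw [lnSigma, h, Real.sqrt_mul (sq_nonneg s), Real.sqrt_sq hs.le, lnSigma]

theorem lnSigma_pos_of_pos {m : ℕ} {ε : ℝ} (hε : 0 < ε) (v : Fin m → ℝ) : 0 < lnSigma ε v :=
  Real.sqrt_pos.2 (by positivity)

theorem lnSigma_zero_single_pos {m : ℕ} {q z : Fin m} (hqz : q ≠ z) :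
    0 < lnSigma 0 (Pi.single q 1 : Fin m → ℝ) := by
  have hm : (0 : ℝ) < m := by exact_mod_cast q.pos
  refine Real.sqrt_pos.2 ?_
  rw [add_zero]
  refine div_pos (Finset.sum_pos' (fun i _ => sq_nonneg _) ⟨z, Finset.mem_univ _, ?_⟩) hm
  have hmean : lnMean (Pi.single q 1 : Fin m → ℝ) = 1 / m := by simp [lnMean]
  rw [hmean, Pi.single_eq_of_ne hqz.symm]
  have : (1 : ℝ) / m ≠ 0 := by positivity
  positivity

theorem layerNorm_dotProduct {m : ℕ} (ε : ℝ) (v ℓ : Fin m → ℝ) (hℓ : ∑ i, ℓ i = 0) :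
    layerNorm ε v ⬝ᵥ ℓ = (v ⬝ᵥ ℓ) / lnSigma ε v := by
  have : ∀ i, layerNorm ε v i * ℓ i = v i * ℓ i / lnSigma ε v - lnMean v / lnSigma ε v * ℓ i := by
    intro i
    rw [layerNorm]
    ring
  rw [dotProduct, Finset.sum_congr rfl fun i _ => this i, Finset.sum_sub_distrib, ← Finset.mul_sum,
    hℓ, mul_zero, sub_zero, ← Finset.sum_div]
  rfl

/-- The factor by which LayerNorm, applied after a shift of size `1 / s` in channel `q` and
rescaled by its value at infinity, differs from the identity; it equals `1` at `s = 0`. -/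
def shiftGain {m : ℕ} (ε : ℝ) (q : Fin m) (s : ℝ) (v : Fin m → ℝ) : ℝ :=
  lnSigma 0 (Pi.single q 1 : Fin m → ℝ) / lnSigma (s ^ 2 * ε) (s • v + Pi.single q 1)

theorem shiftGain_zero {m : ℕ} (ε : ℝ) {q z : Fin m} (hqz : q ≠ z) (v : Fin m → ℝ) :
    shiftGain ε q 0 v = 1 := by
  have := (lnSigma_zero_single_pos hqz).ne'
  simp [shiftGain, this]

theorem continuous_shiftGain {m : ℕ} {ε : ℝ} (hε : 0 < ε) {q z : Fin m} (hqz : q ≠ z) :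
    Continuous fun p : ℝ × (Fin m → ℝ) => shiftGain ε q p.1 p.2 := by
  unfold shiftGain
  refine continuous_const.div ?_ fun p => ?_
  · unfold lnSigma lnMean
    fun_prop
  · rcases eq_or_ne p.1 0 with h | h
    · simpa [h] using (lnSigma_zero_single_pos hqz).ne'
    · exact (lnSigma_pos_of_pos (by positivity) _).ne'

theorem layerNorm_shift_dotProduct {m : ℕ} (ε : ℝ) {q : Fin m} {s : ℝ} (hs : 0 < s)
    (v ℓ : Fin m → ℝ) (hℓ : ∑ i, ℓ i = 0) (hq : ℓ q = 0) :
    layerNorm ε (v + Pi.single q s⁻¹) ⬝ᵥ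
        ((lnSigma 0 (Pi.single q 1 : Fin m → ℝ) / s) • ℓ) = shiftGain ε q s v * (v ⬝ᵥ ℓ) := by
  have hv : s • v + Pi.single q 1 = s • (v + Pi.single q s⁻¹) := by
    rw [smul_add, ← Pi.single_smul, smul_eq_mul, mul_inv_cancel₀ hs.ne']
  rw [dotProduct_smul, layerNorm_dotProduct _ _ _ hℓ, shiftGain, hv, lnSigma_smul hs,
    add_dotProduct, single_dotProduct, hq, mul_zero, add_zero, smul_eq_mul, div_mul_div_comm,
    div_mul_eq_mul_div]

instance (T m : ℕ) : LocallyCompactSpace (Seq T m) :=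
  inferInstanceAs (LocallyCompactSpace (Fin T → Fin m → ℝ))

theorem continuous_entry {T m : ℕ} (t : Fin T) (i : Fin m) : Continuous fun x : Seq T m => x t i :=
  continuous_id.matrix_elem t i

theorem continuous_token {T m : ℕ} (t : Fin T) : Continuous fun x : Seq T m => x t :=
  continuous_pi fun i => continuous_entry t i

/-- The LayerNorm networks with query/key width `2`, as continuous maps. -/
def networkMaps (ϑ ε : ℝ) (T m : ℕ) : Set C(Seq T m, Seq T m) :=
  {Φ | IsNetwork ϑ 2 m (layerNorm ε) Φ}

theorem IsNetwork.comp_isNetwork {ϑ : ℝ} {T dk m : ℕ} {norm : (Fin m → ℝ) → (Fin m → ℝ)}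
    {G H : Seq T m → Seq T m} (hG : IsNetwork ϑ dk m norm G) (hH : IsNetwork ϑ dk m norm H) :
    IsNetwork ϑ dk m norm (G ∘ H) := by
  induction hG with
  | single G hG => exact .comp G H hG hH
  | comp G G' hG _ ih => exact .comp G (G' ∘ H) hG ih

theorem comp_mem_closure_networkMaps {ϑ ε : ℝ} {T m : ℕ} {Φ Ψ : C(Seq T m, Seq T m)}
    (hΦ : Φ ∈ closure (networkMaps ϑ ε T m)) (hΨ : Ψ ∈ closure (networkMaps ϑ ε T m)) :
    Φ.comp Ψ ∈ closure (networkMaps ϑ ε T m) :=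
  map_mem_closure₂ (f := fun Φ Ψ : C(Seq T m, Seq T m) => Φ.comp Ψ)
    (ContinuousMap.continuous_comp'.comp continuous_swap) hΦ hΨ fun Φ h₁ Ψ h₂ =>
      show IsNetwork ϑ 2 m (layerNorm ε) (Φ ∘ Ψ) from IsNetwork.comp_isNetwork h₁ h₂

/-- The effect of a shifted and rescaled block: channel `q` receives
`A(λ ℓ(x) + c) ⬝ (λ ℓ'(x) + c')` with the gain `λ = shiftGain ε q s`. -/
def shiftedWrite {T m : ℕ} (ε : ℝ) (ℓ ℓ' : Fin m → ℝ) (c c' : ℝ) (q : Fin m) (s : ℝ)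
    (x : Seq T m) : Seq T m := fun t i =>
  x t i + if i = q then
    (causalAvg T).mulVec (fun j => shiftGain ε q s (x j) * (x j ⬝ᵥ ℓ) + c) t *
      (shiftGain ε q s (x t) * (x t ⬝ᵥ ℓ') + c') else 0

theorem continuous_shiftedWrite {T m : ℕ} {ε : ℝ} (hε : 0 < ε) (ℓ ℓ' : Fin m → ℝ) (c c' : ℝ)
    {q z : Fin m} (hqz : q ≠ z) :
    Continuous fun p : ℝ × Seq T m => shiftedWrite ε ℓ ℓ' c c' q p.1 p.2 := by
  have hrow (j : Fin T) : Continuous fun p : ℝ × Seq T m => p.2 j :=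
    (continuous_token j).comp continuous_snd
  have hgain (j : Fin T) : Continuous fun p : ℝ × Seq T m => shiftGain ε q p.1 (p.2 j) := by
    have h := (continuous_shiftGain hε hqz).comp (continuous_fst.prodMk (hrow j))
    exact h
  have hdot (j : Fin T) (ℓ : Fin m → ℝ) : Continuous fun p : ℝ × Seq T m => p.2 j ⬝ᵥ ℓ :=
    (hrow j).dotProduct continuous_const
  refine continuous_matrix fun t i => ?_
  unfold shiftedWrite
  refine ((continuous_entry t i).comp continuous_snd).add ?_
  split_ifs
  · refine Continuous.mul ?_ (((hgain t).mul (hdot t ℓ')).add continuous_const)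
    simp only [Matrix.mulVec, dotProduct.eq_1 (causalAvg T t)]
    exact continuous_finsetSum _ fun j _ =>
      continuous_const.mul (((hgain j).mul (hdot j ℓ)).add continuous_const)
  · exact continuous_const

theorem isNetwork_shiftedWrite {T m : ℕ} (ϑ ε : ℝ) {ℓ ℓ' : Fin m → ℝ} (c c' : ℝ)
    {q z : Fin m} (hqz : q ≠ z) (hℓ : ∑ i, ℓ i = 0) (hq : ℓ q = 0) (hℓ' : ∑ i, ℓ' i = 0)
    (hq' : ℓ' q = 0) {s : ℝ} (hs : 0 < s) :
    IsNetwork ϑ 2 m (layerNorm ε) (shiftedWrite (T := T) ε ℓ ℓ' c c' q s) := by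
  -- `H` shifts channel `q` by `1 / s`; the output bias of `G` undoes the shift.
  set κ := lnSigma 0 (Pi.single q 1 : Fin m → ℝ)
  set G : Seq T m → Seq T m := block ϑ (layerNorm ε)
    (writeParams 0 ((κ / s) • ℓ) ((κ / s) • ℓ') c c' q z (-Pi.single q s⁻¹))
  set H : Seq T m → Seq T m := block ϑ (layerNorm ε)
    (writeParams 0 0 0 0 0 q z (Pi.single q s⁻¹))
  have hH (x : Seq T m) (t : Fin T) : H x t = x t + Pi.single q s⁻¹ := by
    ext i
    simp [H, block_writeParams_zero ϑ _ _ _ _ _ hqz]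
  have hGH : shiftedWrite ε ℓ ℓ' c c' q s = G ∘ H := by
    ext x t i
    refine Eq.trans ?_ (block_writeParams_zero ϑ _ _ _ _ _ hqz _ (H x) t i).symm
    simp only [shiftedWrite, hH, κ, layerNorm_shift_dotProduct ε hs _ ℓ hℓ hq,
      layerNorm_shift_dotProduct ε hs _ ℓ' hℓ' hq']
    simp only [Pi.add_apply, Pi.neg_apply]
    ring
  rw [hGH]
  exact .comp G H ⟨_, rfl⟩ (.single H ⟨_, rfl⟩)

/-- The block without LayerNorm that adds `A(ℓ(x) + c) ⬝ (ℓ'(x) + c')` to channel `q`. -/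
def writeMap {m : ℕ} (T : ℕ) (ℓ ℓ' : Fin m → ℝ) (c c' : ℝ) (q : Fin m) : C(Seq T m, Seq T m) where
  toFun x := fun t i => x t i + if i = q then
    (causalAvg T).mulVec (fun j => x j ⬝ᵥ ℓ + c) t * (x t ⬝ᵥ ℓ' + c') else 0
  continuous_toFun := by
    have hdot (j : Fin T) (ℓ : Fin m → ℝ) : Continuous fun x : Seq T m => x j ⬝ᵥ ℓ :=
      (continuous_token j).dotProduct continuous_const
    refine continuous_matrix fun t i => ?_
    refine (continuous_entry t i).add ?_
    split_ifs
    · refine Continuous.mul ?_ ((hdot t ℓ').add continuous_const)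
      simp only [Matrix.mulVec, dotProduct.eq_1 (causalAvg T t)]
      exact continuous_finsetSum _ fun j _ =>
        continuous_const.mul ((hdot j ℓ).add continuous_const)
    · exact continuous_const

/-- Since `1 / s` tends to infinity as `s → 0`, the shifted blocks converge, uniformly on compact
sets, to the block without LayerNorm. -/
theorem writeMap_mem_closure {T m : ℕ} (ϑ : ℝ) {ε : ℝ} (hε : 0 < ε) {ℓ ℓ' : Fin m → ℝ} (c c' : ℝ)
    {q z : Fin m} (hqz : q ≠ z) (hℓ : ∑ i, ℓ i = 0) (hq : ℓ q = 0) (hℓ' : ∑ i, ℓ' i = 0)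
    (hq' : ℓ' q = 0) : writeMap T ℓ ℓ' c c' q ∈ closure (networkMaps ϑ ε T m) := by
  let Γ : C(ℝ, C(Seq T m, Seq T m)) :=
    ContinuousMap.curry ⟨_, continuous_shiftedWrite (T := T) hε ℓ ℓ' c c' hqz⟩
  have h0 : Γ 0 = writeMap T ℓ ℓ' c c' q := by
    ext x t i
    change shiftedWrite ε ℓ ℓ' c c' q 0 x t i = _
    simp only [shiftedWrite, shiftGain_zero ε hqz, one_mul]
    rfl
  rw [← h0]
  refine map_mem_closure (s := Set.Ioi (0 : ℝ)) Γ.continuous (by simp) fun s hs => ?_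
  exact isNetwork_shiftedWrite ϑ ε c c' hqz hℓ hq hℓ' hq' hs

/-- The block that adds the positions to channel `q`. -/
def posMap {m : ℕ} (T : ℕ) (q : Fin m) : C(Seq T m, Seq T m) where
  toFun x := fun t i => x t i + if i = q then feedbackPos t else 0
  continuous_toFun := by
    refine continuous_matrix fun t i => ?_
    exact (continuous_entry t i).add continuous_const

theorem posMap_mem_closure {T m : ℕ} (ϑ ε : ℝ) {q z : Fin m} (hqz : q ≠ z) :
    posMap T q ∈ closure (networkMaps ϑ ε T m) := by
  refine subset_closure (IsNetwork.single _
    ⟨writeParams (Real.artanh (1 / 2)) 0 0 1 1 q z 0, ?_⟩)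
  ext x t i
  exact block_writeParams_feedbackPos ϑ _ hqz x t i

theorem id_mem_closure {T m : ℕ} (ϑ ε : ℝ) {q z : Fin m} (hqz : q ≠ z) :
    ContinuousMap.id _ ∈ closure (networkMaps ϑ ε T m) := by
  refine subset_closure (IsNetwork.single _ ⟨writeParams 0 0 0 0 0 q z 0, ?_⟩)
  ext x t i
  simp [block_writeParams_zero ϑ _ _ _ _ _ hqz]

/-! ### Programs and the algebra of computable channels -/

/-- A real sequence that depends on the input: one coordinate of a token stream. -/
abbrev Channel (T d : ℕ) : Type := Seq T d → Fin T → ℝ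

/-- The causal average of a channel. -/
def Channel.avg {T d : ℕ} (u : Channel T d) : Channel T d := fun x => (causalAvg T).mulVec (u x)

/-- The channels that are affine in the input coordinates and the registers in `L`. -/
def registerSpan {T d : ℕ} (L : List (Channel T d)) : Submodule ℝ (Channel T d) :=
  Submodule.span ℝ
    ({1} ∪ Set.range (fun (i : Fin d) (x : Seq T d) (t : Fin T) => x t i) ∪ {c | c ∈ L})

/-- Straight-line programs, given by the list of registers computed so far, the last one first:
each register is either the position or a product `A(u) ⬝ v`, with `u` and `v` affine in the input
coordinates and the earlier registers. -/
inductive IsProgram {T d : ℕ} : List (Channel T d) → Prop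
  | nil : IsProgram []
  | pos (L : List (Channel T d)) : IsProgram L → IsProgram ((fun _ t => feedbackPos t) :: L)
  | mul (L : List (Channel T d)) (u v : Channel T d) : IsProgram L → u ∈ registerSpan L →
      v ∈ registerSpan L → IsProgram ((u.avg * v) :: L)

section Algebra

variable {T d : ℕ}

theorem registerSpan_mono {L L' : List (Channel T d)} (h : L ⊆ L') :
    registerSpan L ≤ registerSpan L' :=
  Submodule.span_mono (Set.union_subset_union_right _ fun _ hc => h hc)

theorem one_mem_registerSpan (L : List (Channel T d)) : 1 ∈ registerSpan L :=
  Submodule.subset_span (Or.inl (Or.inl rfl))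

theorem input_mem_registerSpan (L : List (Channel T d)) (i : Fin d) :
    (fun x t => x t i) ∈ registerSpan L :=
  Submodule.subset_span (Or.inl (Or.inr ⟨i, rfl⟩))

theorem mem_registerSpan_of_mem {L : List (Channel T d)} {c : Channel T d} (h : c ∈ L) :
    c ∈ registerSpan L :=
  Submodule.subset_span (Or.inr h)

theorem IsProgram.append {L L' : List (Channel T d)} (h : IsProgram L) (h' : IsProgram L') :
    IsProgram (L ++ L') := by
  induction h with
  | nil => exact h'
  | pos L _ ih => exact .pos _ ih
  | mul L u v _ hu hv ih =>
    exact .mul _ u v ih (registerSpan_mono (List.subset_append_left _ _) hu)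
      (registerSpan_mono (List.subset_append_left _ _) hv)

/-- The channels that are affine in the registers of some program. -/
def computableSubmodule (T d : ℕ) : Submodule ℝ (Channel T d) where
  carrier := {c | ∃ L, IsProgram L ∧ c ∈ registerSpan L}
  zero_mem' := ⟨[], .nil, zero_mem _⟩
  add_mem' := by
    rintro a b ⟨L, hL, ha⟩ ⟨L', hL', hb⟩
    exact ⟨L ++ L', hL.append hL', add_mem
      (registerSpan_mono (List.subset_append_left _ _) ha)
      (registerSpan_mono (List.subset_append_right _ _) hb)⟩
  smul_mem' := by
    rintro r a ⟨L, hL, ha⟩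
    exact ⟨L, hL, Submodule.smul_mem _ r ha⟩

theorem avg_mul_mem_computableSubmodule {u v : Channel T d} (hu : u ∈ computableSubmodule T d)
    (hv : v ∈ computableSubmodule T d) : u.avg * v ∈ computableSubmodule T d := by
  obtain ⟨L, hL, hu⟩ := hu
  obtain ⟨L', hL', hv⟩ := hv
  exact ⟨_, .mul (L ++ L') u v (hL.append hL')
    (registerSpan_mono (List.subset_append_left _ _) hu)
    (registerSpan_mono (List.subset_append_right _ _) hv),
    mem_registerSpan_of_mem List.mem_cons_self⟩

theorem one_mem_computableSubmodule : (1 : Channel T d) ∈ computableSubmodule T d :=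
  ⟨[], .nil, one_mem_registerSpan _⟩

theorem avg_mem_computableSubmodule {u : Channel T d} (hu : u ∈ computableSubmodule T d) :
    u.avg ∈ computableSubmodule T d := by
  simpa using avg_mul_mem_computableSubmodule hu one_mem_computableSubmodule

theorem det_causalAvg_ne_zero (T : ℕ) : (causalAvg T).det ≠ 0 := by
  rw [Matrix.det_of_isLowerTriangular]
  · refine Finset.prod_ne_zero_iff.2 fun t _ => ?_
    have : ((t : ℕ) : ℝ) + 1 ≠ 0 := by positivity
    simpa [causalAvg] using this
  · intro i j hij
    have h : i < j := by simpa using hij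
    simp [causalAvg, h.not_ge]

/-- A right inverse of an invertible matrix is a polynomial in it, by Cayley–Hamilton. -/
theorem exists_mul_aeval_eq_one {n : Type*} [Fintype n] [DecidableEq n] {M : Matrix n n ℝ}
    (hM : M.det ≠ 0) : ∃ p : Polynomial ℝ, M * Polynomial.aeval M p = 1 := by
  have h0 : M.charpoly.coeff 0 ≠ 0 := by
    intro h
    exact hM (by rw [Matrix.det_eq_sign_charpoly_coeff, h, mul_zero])
  refine ⟨Polynomial.C (-(M.charpoly.coeff 0)⁻¹) * M.charpoly.divX, ?_⟩
  have h := Matrix.aeval_self_charpoly M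
  rw [← Polynomial.X_mul_divX_add M.charpoly, map_add, map_mul, Polynomial.aeval_X,
    Polynomial.aeval_C, add_eq_zero_iff_eq_neg] at h
  rw [map_mul, Polynomial.aeval_C, ← Algebra.smul_def, mul_smul_comm, h,
    Algebra.algebraMap_eq_smul_one, neg_smul, smul_neg, neg_neg, smul_smul, inv_mul_cancel₀ h0,
    one_smul]

theorem aeval_causalAvg_mem_computableSubmodule (p : Polynomial ℝ) {u : Channel T d}
    (hu : u ∈ computableSubmodule T d) :
    (fun x => (Polynomial.aeval (causalAvg T) p).mulVec (u x)) ∈ computableSubmodule T d := by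
  induction p using Polynomial.induction_on' with
  | add p q hp hq =>
    convert add_mem hp hq using 1
    ext x t
    simp [Matrix.add_mulVec]
  | monomial n a =>
    have hpow : (fun x => (causalAvg T ^ n).mulVec (u x)) ∈ computableSubmodule T d := by
      induction n with
      | zero => simpa using hu
      | succ n ih =>
        convert avg_mem_computableSubmodule ih using 1
        ext x t
        simp [Channel.avg, pow_succ', Matrix.mulVec_mulVec]
    convert Submodule.smul_mem _ a hpow using 1
    ext x t
    simp [Polynomial.aeval_monomial, Algebra.algebraMap_eq_smul_one, Matrix.smul_mulVec]

/-- Products need the inverse of the causal average: `u v = A(A⁻¹ u) v`, where `A⁻¹` is a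
polynomial in `A`, so that `A⁻¹ u` is computed by iterated averaging. -/
theorem mul_mem_computableSubmodule {u v : Channel T d} (hu : u ∈ computableSubmodule T d)
    (hv : v ∈ computableSubmodule T d) : u * v ∈ computableSubmodule T d := by
  obtain ⟨p, hp⟩ := exists_mul_aeval_eq_one (det_causalAvg_ne_zero T)
  convert avg_mul_mem_computableSubmodule (aeval_causalAvg_mem_computableSubmodule p hu) hv using 2
  ext x t
  simp [Channel.avg, Matrix.mulVec_mulVec, hp]

/-- The algebra of the channels that are affine in the registers of some program. -/
def computable (T d : ℕ) : Subalgebra ℝ (Channel T d) :=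
  (computableSubmodule T d).toSubalgebra one_mem_computableSubmodule
    fun _ _ => mul_mem_computableSubmodule

theorem mem_computable {c : Channel T d} :
    c ∈ computable T d ↔ ∃ L, IsProgram L ∧ c ∈ registerSpan L := Iff.rfl

theorem avg_mem_computable {u : Channel T d} (hu : u ∈ computable T d) : u.avg ∈ computable T d :=
  avg_mem_computableSubmodule hu

theorem input_mem_computable (i : Fin d) : (fun x t => x t i) ∈ computable T d :=
  ⟨[], .nil, input_mem_registerSpan _ i⟩

theorem feedbackPos_mem_computable :
    (fun _ t => feedbackPos t : Channel T d) ∈ computable T d :=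
  ⟨_, .pos [] .nil, mem_registerSpan_of_mem List.mem_cons_self⟩

/-- Finitely many computable channels are registers of a single program. -/
theorem exists_isProgram_forall_mem {ι : Type*} (s : Finset ι) (c : ι → Channel T d)
    (hc : ∀ i, c i ∈ computable T d) : ∃ L, IsProgram L ∧ ∀ i ∈ s, c i ∈ L := by
  classical
  induction s using Finset.induction_on with
  | empty => exact ⟨[], .nil, by simp⟩
  | insert a s _ ih =>
    obtain ⟨L, hL, hs⟩ := ih
    obtain ⟨L', hL', ha⟩ := mem_computable.1 (hc a)
    refine ⟨_, (IsProgram.mul L' 1 (c a) hL' (one_mem_registerSpan _) ha).append hL, ?_⟩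
    have h1 : Channel.avg 1 * c a = c a := by
      ext x t
      have : Channel.avg (1 : Channel T d) x = 1 := causalAvg_mulVec_one T
      simp [this]
    intro i hi
    rcases Finset.mem_insert.1 hi with rfl | hi
    · simp [h1]
    · simp [hs i hi]

/-- Position polynomials give the indicator of a single time. -/
theorem indicator_mem_computable (j : Fin T) :
    (fun _ t => if t = j then 1 else 0) ∈ computable T d := by
  have h : (∏ k ∈ Finset.univ.erase j, ((feedbackPos j - feedbackPos k)⁻¹ •
      ((fun _ t => feedbackPos t : Channel T d) - feedbackPos k • (1 : Channel T d)))) ∈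
        computable T d :=
    Subalgebra.prod_mem _ fun k _ => Subalgebra.smul_mem _
      (Subalgebra.sub_mem _ feedbackPos_mem_computable
        (Subalgebra.smul_mem _ (Subalgebra.one_mem _) _)) _
  convert h using 1
  ext x t
  simp only [Finset.prod_apply, Pi.smul_apply, Pi.sub_apply, Pi.one_apply, smul_eq_mul, mul_one]
  split_ifs with htj
  · subst htj
    refine (Finset.prod_eq_one fun k hk => inv_mul_cancel₀ (sub_ne_zero.2 fun he => ?_)).symm
    exact (Finset.ne_of_mem_erase hk) (Fin.ext (strictMono_feedbackPos.injective he)).symm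
  · refine (Finset.prod_eq_zero (Finset.mem_erase.2 ⟨htj, Finset.mem_univ t⟩) ?_).symm
    simp

theorem const_mem_computable (w : Fin T → ℝ) : (fun _ => w) ∈ computable T d := by
  have h : (∑ j, w j • (fun _ t => if t = j then 1 else 0 : Channel T d)) ∈ computable T d :=
    Subalgebra.sum_mem _ fun j _ => Subalgebra.smul_mem _ (indicator_mem_computable j) _
  convert h using 1
  ext x t
  simp [Finset.sum_apply]

/-- The channel that carries the coordinate `i` of the token `j` from time `j` on. -/
theorem broadcast_mem_computable (j : Fin T) (i : Fin d) :
    (fun x t => if j ≤ t then x j i else 0) ∈ computable T d := by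
  -- The causal average of the single nonzero value `x j i` is undone by the factor `t + 1`.
  have h := Subalgebra.mul_mem _ (const_mem_computable (d := d) fun t : Fin T => ((t : ℕ) : ℝ) + 1)
    (avg_mem_computable
      (Subalgebra.mul_mem _ (indicator_mem_computable j) (input_mem_computable i)))
  convert h using 1
  ext x t
  have ht : ((t : ℕ) : ℝ) + 1 ≠ 0 := by positivity
  simp [Channel.avg, causalAvg_mulVec, ht]

end Algebra

/-! ### Realizing programs by networks -/

section Realize

variable {T d m : ℕ}

/-- The state of the network that runs a program: each register, and each input coordinate, sits in
a channel of the finite set `R`, and all other channels vanish. -/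
structure IsState (ι : Fin d → Fin m) (L : List (Channel T d)) (R : Finset (Fin m))
    (Y : Seq T d → Seq T m) : Prop where
  zero : ∀ x t, ∀ i ∉ R, Y x t i = 0
  input_mem : ∀ i, ι i ∈ R
  input : ∀ x t i, Y x t (ι i) = x t i
  register : ∀ c ∈ L, ∃ k ∈ R, k ∉ Set.range ι ∧ ∀ x t, Y x t k = c x t

theorem IsState.exists_affine {ι : Fin d → Fin m} {L : List (Channel T d)} {R : Finset (Fin m)}
    {Y : Seq T d → Seq T m} (h : IsState ι L R Y) {u : Channel T d} (hu : u ∈ registerSpan L) :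
    ∃ (ℓ : Fin m → ℝ) (c : ℝ), ∀ x t, Y x t ⬝ᵥ ℓ + c = u x t := by
  induction hu using Submodule.span_induction with
  | mem u hu =>
    rcases hu with (rfl | ⟨i, rfl⟩) | hu
    · exact ⟨0, 1, by simp⟩
    · exact ⟨Pi.single (ι i) 1, 0, by simp [h.input]⟩
    · obtain ⟨k, _, _, hk⟩ := h.register u hu
      exact ⟨Pi.single k 1, 0, by simp [hk]⟩
  | zero => exact ⟨0, 0, by simp⟩
  | add u v _ _ hu hv =>
    obtain ⟨ℓ, c, hu⟩ := hu
    obtain ⟨ℓ', c', hv⟩ := hv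
    refine ⟨ℓ + ℓ', c + c', fun x t => ?_⟩
    rw [dotProduct_add, Pi.add_apply, Pi.add_apply, ← hu, ← hv]
    ring
  | smul r u _ hu =>
    obtain ⟨ℓ, c, hu⟩ := hu
    refine ⟨r • ℓ, r * c, fun x t => ?_⟩
    rw [dotProduct_smul, Pi.smul_apply, Pi.smul_apply, ← hu, smul_eq_mul, smul_eq_mul]
    ring

/-- The functional may be chosen to ignore the unused channel `q` and, thanks to the unused channel
`z`, to have coefficient sum zero, so that it does not see the mean subtracted by LayerNorm. -/
theorem IsState.exists_affine_sum_eq_zero {ι : Fin d → Fin m} {L : List (Channel T d)}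
    {R : Finset (Fin m)} {Y : Seq T d → Seq T m} (h : IsState ι L R Y) {u : Channel T d}
    (hu : u ∈ registerSpan L) {q z : Fin m} (hq : q ∉ R) (hz : z ∉ R) (hqz : q ≠ z) :
    ∃ (ℓ : Fin m → ℝ) (c : ℝ), ∑ i, ℓ i = 0 ∧ ℓ q = 0 ∧ ∀ x t, Y x t ⬝ᵥ ℓ + c = u x t := by
  obtain ⟨ℓ, c, hℓ⟩ := h.exists_affine hu
  refine ⟨fun i => (if i ∈ R then ℓ i else 0) + if i = z then -∑ k ∈ R, ℓ k else 0, c, ?_, ?_, ?_⟩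
  · simp [Finset.sum_add_distrib]
  · simp [hq, hqz]
  · intro x t
    rw [← hℓ x t, dotProduct, dotProduct]
    congr 1
    refine Finset.sum_congr rfl fun i _ => ?_
    by_cases hi : i ∈ R
    · have : i ≠ z := fun he => hz (he ▸ hi)
      simp [hi, this]
    · simp [h.zero x t i hi]

/-- Writing a new register to an unused channel. -/
theorem IsState.insert {ι : Fin d → Fin m} {L : List (Channel T d)} {R : Finset (Fin m)}
    {Y : Seq T d → Seq T m} (h : IsState ι L R Y) {q : Fin m} (hq : q ∉ R) (c : Channel T d)
    {Y' : Seq T d → Seq T m} (hY' : ∀ x t i, Y' x t i = Y x t i + if i = q then c x t else 0) :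
    IsState ι (c :: L) (insert q R) Y' where
  zero x t i hi := by
    rw [Finset.mem_insert, not_or] at hi
    simp [hY', hi.1, h.zero x t i hi.2]
  input_mem i := Finset.mem_insert_of_mem (h.input_mem i)
  input x t i := by
    have : ι i ≠ q := fun he => hq (he ▸ h.input_mem i)
    simp [hY', this, h.input]
  register c' hc' := by
    rcases List.mem_cons.1 hc' with rfl | hc'
    · refine ⟨q, Finset.mem_insert_self _ _, ?_, fun x t => by simp [hY', h.zero x t q hq]⟩
      rintro ⟨i, hi⟩
      exact hq (hi ▸ h.input_mem i)
    · obtain ⟨k, hkR, hk, hkc⟩ := h.register c' hc'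
      have : k ≠ q := fun he => hq (he ▸ hkR)
      exact ⟨k, Finset.mem_insert_of_mem hkR, hk, fun x t => by simp [hY', this, hkc]⟩

/-- Tokenwise embedding that copies the input coordinates to the channels `ι`. -/
def embedMatrix (ι : Fin d → Fin m) : Matrix (Fin d) (Fin m) ℝ :=
  fun i k => if k = ι i then 1 else 0

theorem isState_embed {ι : Fin d → Fin m} (hι : Function.Injective ι) :
    IsState ι [] (Finset.univ.image ι) (adapter (T := T) (embedMatrix ι) 0) where
  zero x t i hi := by
    have : ∀ k, i ≠ ι k := fun k he => hi (by simp [he])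
    simp [adapter, embedMatrix, Matrix.vecMul, dotProduct, this]
  input_mem i := by simp
  input x t i := by simp [adapter, embedMatrix, Matrix.vecMul, dotProduct, hι.eq_iff]
  register c hc := by simp at hc

/-- Every program is run, in width at least `d + L.length + 2`, by a map in the closure of the
networks. The two spare channels serve, at each step, as the channel to be written (and shifted
before LayerNorm) and as the zero reference. -/
theorem IsProgram.exists_isState {L : List (Channel T d)} (hL : IsProgram L) (ϑ : ℝ) {ε : ℝ}
    (hε : 0 < ε) {ι : Fin d → Fin m} (hι : Function.Injective ι) (hm : d + L.length + 2 ≤ m) :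
    ∃ Ψ ∈ closure (networkMaps ϑ ε T m), ∃ R : Finset (Fin m), R.card ≤ d + L.length ∧
      IsState ι L R fun x => Ψ (adapter (embedMatrix ι) 0 x) := by
  have key : ∀ R : Finset (Fin m), R.card + 2 ≤ m → ∃ q z : Fin m, q ∉ R ∧ z ∉ R ∧ q ≠ z := by
    intro R hR
    have hc : 1 < Rᶜ.card := by
      rw [Finset.card_compl, Fintype.card_fin]
      omega
    obtain ⟨q, hq, z, hz, hqz⟩ := Finset.one_lt_card.1 hc
    exact ⟨q, z, Finset.mem_compl.1 hq, Finset.mem_compl.1 hz, hqz⟩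
  induction hL with
  | nil =>
    have hcard : (Finset.univ.image ι).card ≤ d := Finset.card_image_le.trans (by simp)
    simp only [List.length_nil, add_zero] at hm
    obtain ⟨q, z, _, _, hqz⟩ := key (Finset.univ.image ι) (by omega)
    exact ⟨_, id_mem_closure ϑ ε hqz, _, by simpa using hcard, isState_embed hι⟩
  | pos L _ ih =>
    rw [List.length_cons] at hm
    obtain ⟨Ψ, hΨ, R, hR, hst⟩ := ih (by omega)
    obtain ⟨q, z, hq, hz, hqz⟩ := key R (by omega)
    refine ⟨_, comp_mem_closure_networkMaps (posMap_mem_closure ϑ ε hqz) hΨ, insert q R,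
      ?_, hst.insert hq _ fun x t i => rfl⟩
    rw [Finset.card_insert_of_notMem hq, List.length_cons]
    omega
  | mul L u v _ hu hv ih =>
    rw [List.length_cons] at hm
    obtain ⟨Ψ, hΨ, R, hR, hst⟩ := ih (by omega)
    obtain ⟨q, z, hq, hz, hqz⟩ := key R (by omega)
    obtain ⟨ℓ, c, hℓ, hℓq, hu⟩ := hst.exists_affine_sum_eq_zero hu hq hz hqz
    obtain ⟨ℓ', c', hℓ', hℓq', hv⟩ := hst.exists_affine_sum_eq_zero hv hq hz hqz
    refine ⟨_, comp_mem_closure_networkMaps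
      (writeMap_mem_closure ϑ hε c c' hqz hℓ hℓq hℓ' hℓq') hΨ, insert q R,
      ?_, hst.insert hq _ fun x t i => ?_⟩
    · rw [Finset.card_insert_of_notMem hq, List.length_cons]
      omega
    · change _ + (if i = q then (causalAvg T).mulVec
        (fun j => Ψ (adapter (embedMatrix ι) 0 x) j ⬝ᵥ ℓ + c) t *
          (Ψ (adapter (embedMatrix ι) 0 x) t ⬝ᵥ ℓ' + c') else 0) = _
      simp only [hu, hv]
      rfl

end Realize

/-! ### Density of the computable channels -/

section Density

variable {T d : ℕ}

/-- The prefix of `x` up to time `t`, with the later tokens replaced by zero. -/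
def truncate (t : Fin T) (x : Seq T d) : Seq T d := fun j i => if j ≤ t then x j i else 0

theorem continuous_truncate (t : Fin T) : Continuous (truncate (d := d) t) := by
  refine continuous_matrix fun j i => ?_
  unfold truncate
  split_ifs
  · exact continuous_entry j i
  · exact continuous_const

/-- Stone–Weierstrass on the compact set of prefixes of length `t + 1`. -/
theorem exists_computable_near {D : Set (Seq T d)} (hD : IsCompact D) (t : Fin T) (f : C(D, ℝ))
    (hf : ∀ x x' : D, (∀ j ≤ t, x.1 j = x'.1 j) → f x = f x') {δ : ℝ} (hδ : 0 < δ) :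
    ∃ c ∈ computable T d, ∀ x : D, |c x.1 t - f x| < δ := by
  have : CompactSpace D := isCompact_iff_compactSpace.1 hD
  let K : Set (Seq T d) := truncate t '' D
  have : CompactSpace K := isCompact_iff_compactSpace.1 (hD.image (continuous_truncate t))
  let π : C(D, K) := ⟨fun x => ⟨truncate t x.1, x.1, x.2, rfl⟩,
    ((continuous_truncate t).comp continuous_subtype_val).subtype_mk _⟩
  have hπs : Function.Surjective π := by
    rintro ⟨_, x, hx, rfl⟩
    exact ⟨⟨x, hx⟩, rfl⟩
  have hπ : Topology.IsQuotientMap π := π.continuous.isClosedMap.isQuotientMap π.continuous hπs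
  have hfac : Function.FactorsThrough f π := by
    intro x x' h
    refine hf x x' fun j hj => ?_
    ext i
    have h' : truncate t x.1 j i = truncate t x'.1 j i :=
      congrFun (congrFun (congrArg Subtype.val h) j) i
    simpa [truncate, hj] using h'
  -- The functions of the prefix that are the value at time `t` of a computable channel.
  let A : Subalgebra ℝ C(K, ℝ) :=
    { carrier := {g | ∃ c ∈ computable T d, ∀ x : D, c x.1 t = g (π x)}
      mul_mem' := by
        rintro g g' ⟨c, hc, h⟩ ⟨c', hc', h'⟩
        exact ⟨c * c', mul_mem hc hc', fun x => by simp [h, h']⟩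
      add_mem' := by
        rintro g g' ⟨c, hc, h⟩ ⟨c', hc', h'⟩
        exact ⟨c + c', add_mem hc hc', fun x => by simp [h, h']⟩
      algebraMap_mem' := fun r => ⟨algebraMap ℝ _ r, Subalgebra.algebraMap_mem _ r, fun x => by
        simp [Algebra.algebraMap_eq_smul_one]⟩ }
  have hA : A.SeparatesPoints := by
    intro y y' hne
    obtain ⟨j, i, hji⟩ : ∃ j i, y.1 j i ≠ y'.1 j i := by
      by_contra! h
      exact hne (Subtype.ext (Matrix.ext h))
    refine ⟨_, ⟨⟨fun y : K => y.1 j i, (continuous_entry j i).comp continuous_subtype_val⟩,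
      ?_, rfl⟩, hji⟩
    exact ⟨_, broadcast_mem_computable j i, fun x => rfl⟩
  obtain ⟨⟨g, c, hc, hcg⟩, hg⟩ :=
    ContinuousMap.exists_mem_subalgebra_near_continuousMap_of_separatesPoints A hA
      (hπ.lift f hfac) δ hδ
  refine ⟨c, hc, fun x => ?_⟩
  have h1 : hπ.lift f hfac (π x) = f x :=
    congrArg (fun h : C(D, ℝ) => h x) (hπ.lift_comp f hfac)
  have h2 := (ContinuousMap.norm_coe_le_norm (g - hπ.lift f hfac) (π x)).trans_lt hg
  rwa [ContinuousMap.sub_apply, h1, ← hcg, Real.norm_eq_abs] at h2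

theorem exists_computable_near_causal {D : Set (Seq T d)} (hD : IsCompact D) {F : D → Seq T d}
    (hF : Continuous F) (hcausal : Causal F) (i : Fin d) {δ : ℝ} (hδ : 0 < δ) :
    ∃ c ∈ computable T d, ∀ (x : D) (t : Fin T), |c x.1 t - F x t i| < δ := by
  -- Approximate each time separately, then select by the indicators of single times.
  choose c hc hcF using fun t : Fin T => exists_computable_near hD t
    ⟨fun x => F x t i, (continuous_entry t i).comp hF⟩
    (fun x x' h => congrFun (hcausal t x x' h) i) hδ
  refine ⟨∑ s, (fun _ t => if t = s then 1 else 0) * c s, Subalgebra.sum_mem _ fun s _ =>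
    Subalgebra.mul_mem _ (indicator_mem_computable s) (hc s), fun x t => ?_⟩
  have : (∑ s, (fun _ t => if t = s then 1 else 0) * c s : Channel T d) x.1 t = c t x.1 t := by
    simp [Finset.sum_apply]
  rw [this]
  exact hcF t x

end Density

/-! ### Approximation -/

theorem frobNorm_le {T d : ℕ} {X : Seq T d} {δ : ℝ} (hδ : 0 ≤ δ) (h : ∀ t i, |X t i| ≤ δ) :
    frobNorm X ≤ (T * d + 1) * δ := by
  refine Real.sqrt_le_iff.2 ⟨by positivity, ?_⟩
  have h1 : ∑ t, ∑ i, X t i ^ 2 ≤ ∑ _t : Fin T, ∑ _i : Fin d, δ ^ 2 :=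
    Finset.sum_le_sum fun t _ => Finset.sum_le_sum fun i _ => sq_le_sq' (abs_le.1 (h t i)).1
      (abs_le.1 (h t i)).2
  have h2 : ∑ _t : Fin T, ∑ _i : Fin d, δ ^ 2 = T * d * δ ^ 2 := by simp [mul_assoc]
  have h3 : (0 : ℝ) ≤ T * d := by positivity
  nlinarith [sq_nonneg δ, mul_nonneg h3 (sq_nonneg δ), mul_nonneg (mul_nonneg h3 h3) (sq_nonneg δ)]

theorem continuous_frobNorm {T d : ℕ} : Continuous (frobNorm (T := T) (m := d)) :=
  Real.continuous_sqrt.comp <| continuous_finsetSum _ fun t _ => continuous_finsetSum _ fun i _ =>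
    (continuous_entry t i).pow 2

theorem continuous_adapter {T d m : ℕ} (W : Matrix (Fin d) (Fin m) ℝ) (b : Fin m → ℝ) :
    Continuous (adapter (T := T) W b) := by
  refine continuous_matrix fun t i => ?_
  exact ((continuous_token t).dotProduct continuous_const).add continuous_const

/-- A strict uniform bound on the compact set `D` that holds for a limit of networks holds for some
network. -/
theorem exists_isNetwork_forall_lt {T d m : ℕ} {ϑ ε : ℝ} {D : Set (Seq T d)} (hD : IsCompact D)
    {F : D → Seq T d} (hF : Continuous F) (Wemb : Matrix (Fin d) (Fin m) ℝ)
    (Wun : Matrix (Fin m) (Fin d) ℝ) {Ψ : C(Seq T m, Seq T m)}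
    (hΨ : Ψ ∈ closure (networkMaps ϑ ε T m)) {η : ℝ}
    (h : ∀ x : D, frobNorm (F x - adapter Wun 0 (Ψ (adapter Wemb 0 x.1))) < η) :
    ∃ G, IsNetwork ϑ 2 m (layerNorm ε) G ∧
      ∀ x : D, frobNorm (F x - adapter Wun 0 (G (adapter Wemb 0 x.1))) < η := by
  have : CompactSpace D := isCompact_iff_compactSpace.1 hD
  have hcont : Continuous fun p : C(Seq T m, Seq T m) × D =>
      frobNorm (F p.2 - adapter Wun 0 (p.1 (adapter Wemb 0 p.2.1))) := by
    have h1 : Continuous fun p : C(Seq T m, Seq T m) × D => p.1 (adapter Wemb 0 p.2.1) :=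
      continuous_eval.comp (continuous_fst.prodMk
        ((continuous_adapter Wemb 0).comp (continuous_subtype_val.comp continuous_snd)))
    exact continuous_frobNorm.comp
      ((hF.comp continuous_snd).sub ((continuous_adapter Wun 0).comp h1))
  let E : C(C(Seq T m, Seq T m), C(D, ℝ)) := ContinuousMap.curry ⟨_, hcont⟩
  have hopen : IsOpen (E ⁻¹' {g : C(D, ℝ) | Set.MapsTo g Set.univ (Set.Iio η)}) :=
    (ContinuousMap.isOpen_setOfPred_mapsTo isCompact_univ isOpen_Iio).preimage E.continuous
  obtain ⟨G, hG, hGnet⟩ := mem_closure_iff.1 hΨ _ hopen fun x _ => h x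
  exact ⟨G, hGnet, fun x => hG (Set.mem_univ x)⟩

end Sessa

end

theorem mainTheorem12 (T d : ℕ) (hT : 1 ≤ T) (hd : 1 ≤ d)
    (ϑ : ℝ) (hϑ : 1 < ϑ) (εln : ℝ) (hεln : 0 < εln)
    (D : Set (Sessa.Seq T d)) (hD : IsCompact D)
    (F : D → Sessa.Seq T d) (hF : Continuous F) (hcausal : Sessa.Causal F)
    (ε : ℝ) (hε : 0 < ε) :
    ∃ m dk : ℕ, d ≤ m ∧ 2 ≤ m ∧ Even dk ∧ 2 ≤ dk ∧
      ∃ (Wemb : Matrix (Fin d) (Fin m) ℝ) (bemb : Fin m → ℝ)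
        (Wun : Matrix (Fin m) (Fin d) ℝ) (bun : Fin d → ℝ)
        (G : Sessa.Seq T m → Sessa.Seq T m),
        (∀ x : Sessa.Seq T d, Sessa.adapter Wun bun (Sessa.adapter Wemb bemb x) = x) ∧
        Sessa.IsNetwork ϑ dk m (Sessa.layerNorm εln) G ∧
        BddAbove (Set.range fun x : D =>
          Sessa.frobNorm (F x - Sessa.adapter Wun bun (G (Sessa.adapter Wemb bemb x.1)))) ∧
        (⨆ x : D,
          Sessa.frobNorm (F x - Sessa.adapter Wun bun (G (Sessa.adapter Wemb bemb x.1)))) < ε := by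
  have hN : (0 : ℝ) < T * d + 1 := by positivity
  set δ : ℝ := ε / (4 * (T * d + 1)) with hδ_def
  have hδ : 0 < δ := by positivity
  choose c hc hcF using fun i => Sessa.exists_computable_near_causal hD hF hcausal i hδ
  -- The registers hold the increments `c i - x i`, which the unembedding adds to the input.
  obtain ⟨L, hL, hcL⟩ := Sessa.exists_isProgram_forall_mem Finset.univ
    (fun i => c i - fun x t => x t i)
    fun i => Subalgebra.sub_mem _ (hc i) (Sessa.input_mem_computable i)
  let m := d + (L.length + 2)
  let ι : Fin d → Fin m := Fin.castAdd (L.length + 2)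
  have hι : Function.Injective ι := Fin.castAdd_injective d (L.length + 2)
  obtain ⟨Ψ, hΨ, R, _, hst⟩ := hL.exists_isState ϑ hεln hι (by omega)
  choose r _ hrι hr using fun i => hst.register _ (hcL i (Finset.mem_univ i))
  let Wun : Matrix (Fin m) (Fin d) ℝ := fun k i =>
    (if k = ι i then 1 else 0) + if k = r i then 1 else 0
  have hun (h : Sessa.Seq T m) (t : Fin T) (i : Fin d) :
      Sessa.adapter Wun 0 h t i = h t (ι i) + h t (r i) := by
    simp [Sessa.adapter, Wun, Matrix.vecMul, dotProduct, mul_add, Finset.sum_add_distrib]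
  have hlim (x : D) : Sessa.frobNorm
      (F x - Sessa.adapter Wun 0 (Ψ (Sessa.adapter (Sessa.embedMatrix ι) 0 x.1))) < ε / 2 := by
    have hle : (T * d + 1) * δ < ε / 2 := by
      rw [hδ_def]
      field_simp
      norm_num
    refine (Sessa.frobNorm_le hδ.le fun t i => ?_).trans_lt hle
    have hx : (F x - Sessa.adapter Wun 0 (Ψ (Sessa.adapter (Sessa.embedMatrix ι) 0 x.1))) t i =
        F x t i - c i x.1 t := by
      rw [Matrix.sub_apply, hun, hst.input, hr]
      simp
    rw [hx, abs_sub_comm]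
    exact (hcF i x t).le
  obtain ⟨G, hG, hGF⟩ := Sessa.exists_isNetwork_forall_lt hD hF _ Wun hΨ hlim
  refine ⟨m, 2, by omega, by omega, even_two, le_rfl, Sessa.embedMatrix ι, 0, Wun, 0, G, ?_, hG,
    ⟨ε / 2, ?_⟩, ?_⟩
  · intro x
    have h0 := Sessa.isState_embed (T := T) hι
    ext t i
    have hri : r i ∉ Finset.univ.image ι := by simpa using hrι i
    rw [hun, h0.input, h0.zero x t _ hri, add_zero]
  · rintro _ ⟨x, rfl⟩
    exact (hGF x).le
  · exact (Real.iSup_le (fun x => (hGF x).le) (by positivity)).trans_lt (half_lt_self hε)
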